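/- For a Dirichlet series $\sum_{n\ge1} a_n n^{-s}$ with complex coefficients, let $A\in[-\infty,\infty]$ be its abscissa of absolute convergence (the infimum of the real $x$ such that the series converges absolutely whenever $\operatorname{Re}s\ge x$) and let $B\in[-\infty,\infty]$ be its abscissa of uniform convergence (the infimum of the real $x$ such that the series, summed in its natural order, converges uniformly on $\{s:\operatorname{Re}s\ge x\}$). Let $p_1=2<p_2=3<\cdots$ be the primes. There are a constant $c$, polynomials $Q_k$ $(k\ge2)$ and a Dirichlet series $\sum_{n\ge1} a_n n^{-s}$ with all $a_n\in\{0,1,-1\}$ such that: 1. For each $k\ge 2$, $Q_k$ is a homogeneous polynomial of degree $k$ in $2^k$ complex variables in which every monomial of degree $k$ has coefficient $+1$ or $-1$, and $|Q_k(z)|<c\,(2^k)^{(k+1)/2}\sqrt{\log k}$ whenever all $|z_j|\le1$. 2. For $k\ge2$ let $\mathcal N_k$ be the set of integers that are products of exactly $k$ primes, counted with multiplicity, from the block $p_{2^k},p_{2^k+1},\dots,p_{2^{k+1}-1}$ of $2^k$ consecutive primes. The sets $\mathcal N_k$ are pairwise disjoint, $a_n=0$ if $n$ lies in no $\mathcal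 N_k$, and if $n=\prod_{j=1}^{2^k}p_{2^k+j-1}^{\alpha_j}\in\mathcal N_k$ then $a_n$ is the coefficient of $z^\alpha$ in $Q_k$. Consequently $\sum_{n\in\mathcal N_k}a_n n^{-s}=Q_k\bigl(p_{2^k}^{-s},\dots,p_{2^{k+1}-1}^{-s}\bigr)$ for all $s\in\mathbb C$. 3. For every $\delta>0$ the series, summed in its natural order, converges uniformly on $\{s:\operatorname{Re}s\ge\frac12+\delta\}$, but it does not converge absolutely at any $s$ with $\operatorname{Re}s<1$. It has $A=1$ and $B=\frac12$, so that $A-B=\frac12$. Moreover (Bohnenblust–Hille), the largest width $A-B$ of the strip of uniform but not absolute convergence, over all Dirichlet series, is exactly $\frac12$: it never exceeds $\frac12$ (where no width is assigned if $A=B=\pm\infty$), and $\frac12$ is attained. -/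

import Mathlib

open Filter

noncomputable section

namespace BohrStrip

/-- The `N`-th partial sum `∑_{n=1}^N a n / n ^ s`, in the natural order, of the Dirichlet series
with coefficients `a`. (`LSeries.term a s n` is `a n / n ^ s` for `n ≠ 0`, and `0` for `n = 0`.) -/
def partialSum (a : ℕ → ℂ) (N : ℕ) (s : ℂ) : ℂ :=
  ∑ n ∈ Finset.Icc 1 N, LSeries.term a s n

/-- The Dirichlet series, summed in its natural order, converges uniformly on `S`. -/
def ConvergesUniformlyOn (a : ℕ → ℂ) (S : Set ℂ) : Prop :=
  ∃ f : ℂ → ℂ, TendstoUniformlyOn (partialSum a) f atTop S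

/-- The Dirichlet series converges absolutely at `s`. -/
def ConvergesAbsolutelyAt (a : ℕ → ℂ) (s : ℂ) : Prop :=
  Summable fun n : ℕ => ‖LSeries.term a s n‖

/-- The abscissa of uniform convergence: the infimum of the real numbers `x` such that the series
converges uniformly on the half-plane `x ≤ Re s`. -/
def abscissaUnif (a : ℕ → ℂ) : EReal :=
  sInf (Real.toEReal '' {x : ℝ | ConvergesUniformlyOn a {s : ℂ | x ≤ s.re}})

/-- The width of the vertical strip of uniform, but not absolute, convergence. If the two abscissae
are both `+∞` or both `-∞` there is no strip, and the value in `EReal` is then `⊥`. -/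
def stripWidth (a : ℕ → ℂ) : EReal :=
  LSeries.abscissaOfAbsConv a - abscissaUnif a

/-- `Q` is homogeneous of degree `m` in `n` variables, every monomial of degree `m` occurring in it
with coefficient `1` or `-1`. -/
def IsSignPolynomial (m n : ℕ) (Q : MvPolynomial (Fin n) ℂ) : Prop :=
  Q.IsHomogeneous m ∧
    ∀ α : Fin n →₀ ℕ, α.degree = m → (Q.coeff α = 1 ∨ Q.coeff α = -1)

/-- The `2 ^ k` consecutive primes starting with the `2 ^ k`-th prime, where `2` is the first prime
(`Nat.nth Nat.Prime` counts from `0`). -/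
def blockPrime (k : ℕ) (j : Fin (2 ^ k)) : ℕ :=
  Nat.nth Nat.Prime (2 ^ k - 1 + (j : ℕ))

/-- The integer that corresponds to the monomial with exponents `α` in the `k`-th block. -/
def blockInt (k : ℕ) (α : Fin (2 ^ k) →₀ ℕ) : ℕ :=
  ∏ j, blockPrime k j ^ α j

/-- The integers of the `k`-th block: the products of exactly `k` primes, counted with multiplicity,
from the `k`-th block of primes. -/
def block (k : ℕ) : Finset ℕ :=
  (Finset.finsuppAntidiag (Finset.univ : Finset (Fin (2 ^ k))) k).image (blockInt k)

/-- `a` is the coefficient sequence assembled from the polynomials `Q k`, `k ≥ 2`: the coefficient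
at the integer of a degree `k` monomial of the `k`-th block is the coefficient of that monomial in
`Q k`, and all the other coefficients vanish. -/
def IsAssembledFrom (a : ℕ → ℂ) (Q : (k : ℕ) → MvPolynomial (Fin (2 ^ k)) ℂ) : Prop :=
  (∀ k : ℕ, 2 ≤ k → ∀ α : Fin (2 ^ k) →₀ ℕ, α.degree = k → a (blockInt k α) = (Q k).coeff α) ∧
    ∀ n : ℕ, (∀ k : ℕ, 2 ≤ k → n ∉ block k) → a n = 0

end BohrStrip

end

/-! Upper bound 1/2: uniform convergence on a half-plane `Re s ≥ x` bounds all late partial sums on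
the line `Re s = x`. A discrete mean along that line (Bessel, `sum_sq_norm_le_of_norm_sum_pow_le`)
then gives `∑ |a_n|² n^(-2x) < ∞`, and pairing with the square-summable `n^(-(y-x))` gives absolute
convergence for `y > x + 1/2`.

Sharpness: write `n = 2^k`. A degree `k` polynomial in `n` variables with all coefficients `±1` has
at least `n^k / k!` monomials, yet suitable signs keep its sup norm on the polydisc of order
`n^((k+1)/2)`. Putting `p^(-s)` for the variables, with primes `p ≥ n`, homogeneity gains `n^(-k Re
s)`, so the blocks are summable for `Re s > 1/2`. By Chebyshev the primes of the block are, for each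
`τ < 1`, at most a constant times `n^(1/τ)`, so the absolute values of the block's terms add up to
more than any constant when `Re s < 1` and `k` is large.

The natural order cuts blocks in the middle, so the signs must control every truncation of the
polynomial at once (`exists_signs_truncations_le`). A block has no more nonempty truncations than
monomials, and their number enters the bound only through its logarithm. The resulting bound has no
factor `√(log k)`: the `k²` in the logarithm of the net size is paid for by the `k!` in the count of
monomials. -/

namespace BohrStrip

/-! ### Choice of signs, nets of the disc and the Kahane-Salem-Zygmund inequality -/

/-- Signs can be chosen so that many signed sums are simultaneously small. -/
theorem exists_signs_abs_sum_le {ι κ : Type*} (s : Finset ι) (V : Finset κ) (x : κ → ι → ℝ)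
    (hx : ∀ v i, |x v i| ≤ 1) {C t : ℝ} (hC : (V.card : ℝ) ≤ C) (ht : 0 < t) :
    ∃ ε : ι → ℝ, (∀ i, ε i = 1 ∨ ε i = -1) ∧
      ∀ v ∈ V, |∑ i ∈ s, ε i * x v i| ≤ Real.log (2 * C) / t + t * s.card / 2 := by
  classical
  -- Signs are fixed one at a time, keeping the exponential potential at most its average over the
  -- next sign, so no probability space is needed.
  have key : ∃ ε : ι → ℝ, (∀ i, ε i = 1 ∨ ε i = -1) ∧
      ∑ v ∈ V, Real.cosh (t * ∑ i ∈ s, ε i * x v i) ≤ C * Real.exp (t ^ 2 * s.card / 2) := by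
    induction s using Finset.induction_on with
    | empty => exact ⟨fun _ => 1, fun _ => Or.inl rfl, by simpa using hC⟩
    | insert i s hi ih =>
      obtain ⟨ε, hε, h⟩ := ih
      set S : κ → ℝ := fun v => ∑ j ∈ s, ε j * x v j
      have hsum : ∀ (e : ℝ) (v : κ),
          ∑ j ∈ insert i s, (Function.update ε i e) j * x v j = e * x v i + S v := by
        intro e v
        rw [Finset.sum_insert hi, Function.update_self]
        congr 1
        refine Finset.sum_congr rfl fun j hj => ?_
        rw [Function.update_of_ne (by rintro rfl; exact hi hj)]
      have hcosh : ∀ v, Real.cosh (t * x v i) ≤ Real.exp (t ^ 2 / 2) := by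
        intro v
        refine (Real.cosh_le_exp_half_sq _).trans (Real.exp_le_exp.2 ?_)
        have h1 : x v i ^ 2 ≤ 1 := (sq_le_one_iff_abs_le_one _).2 (hx v i)
        rw [mul_pow]
        nlinarith [sq_nonneg t]
      -- By `cosh (a + b) + cosh (a - b) = 2 cosh a cosh b`, the two choices of the new sign
      -- multiply the potential on average by at most `exp (t² / 2)`; one of them does no worse.
      have hadd : ∑ v ∈ V, Real.cosh (t * (1 * x v i + S v)) +
          ∑ v ∈ V, Real.cosh (t * (-1 * x v i + S v)) ≤
          2 * (C * Real.exp (t ^ 2 * (insert i s).card / 2)) := by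
        calc _ = ∑ v ∈ V, 2 * (Real.cosh (t * x v i) * Real.cosh (t * S v)) := by
              rw [← Finset.sum_add_distrib]
              refine Finset.sum_congr rfl fun v _ => ?_
              rw [show t * (1 * x v i + S v) = t * S v + t * x v i by ring,
                show t * (-1 * x v i + S v) = t * S v - t * x v i by ring,
                Real.cosh_add, Real.cosh_sub]
              ring
          _ ≤ ∑ v ∈ V, 2 * (Real.exp (t ^ 2 / 2) * Real.cosh (t * S v)) := by
              gcongr with v
              exact hcosh v
          _ = 2 * (Real.exp (t ^ 2 / 2) * ∑ v ∈ V, Real.cosh (t * S v)) := by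
              rw [Finset.mul_sum, Finset.mul_sum]
          _ ≤ 2 * (Real.exp (t ^ 2 / 2) * (C * Real.exp (t ^ 2 * s.card / 2))) := by gcongr
          _ = _ := by
              rw [Finset.card_insert_of_notMem hi, mul_left_comm (Real.exp _), ← Real.exp_add]
              push_cast
              ring_nf
      have hsign : ∀ e : ℝ, (e = 1 ∨ e = -1) →
          ∀ j, Function.update ε i e j = 1 ∨ Function.update ε i e j = -1 := by
        intro e he j
        by_cases hj : j = i
        · subst hj; simpa using he
        · simpa [Function.update_of_ne hj] using hε j
      rcases le_or_gt (∑ v ∈ V, Real.cosh (t * (1 * x v i + S v)))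
        (C * Real.exp (t ^ 2 * (insert i s).card / 2)) with h1 | h1
      · exact ⟨_, hsign 1 (Or.inl rfl), by simpa only [hsum] using h1⟩
      · exact ⟨_, hsign (-1) (Or.inr rfl), by simp only [hsum]; linarith⟩
  obtain ⟨ε, hε, h⟩ := key
  refine ⟨ε, hε, fun v hv => ?_⟩
  set S := ∑ i ∈ s, ε i * x v i
  have h1 : Real.exp |t * S| ≤ 2 * C * Real.exp (t ^ 2 * s.card / 2) := by
    have h2 : Real.cosh (t * S) ≤ C * Real.exp (t ^ 2 * s.card / 2) :=
      (Finset.single_le_sum (f := fun v => Real.cosh (t * ∑ i ∈ s, ε i * x v i))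
        (fun _ _ => (Real.cosh_pos _).le) hv).trans h
    rw [← Real.cosh_abs, Real.cosh_eq] at h2
    nlinarith [Real.exp_pos (-|t * S|)]
  have hC0 : 0 < 2 * C := by
    by_contra hneg
    nlinarith [Real.exp_pos |t * S|, Real.exp_pos (t ^ 2 * s.card / 2)]
  have h3 : |t * S| ≤ Real.log (2 * C) + t ^ 2 * s.card / 2 := by
    rw [← Real.log_exp (|t * S|), ← Real.log_exp (t ^ 2 * s.card / 2),
      ← Real.log_mul hC0.ne' (Real.exp_pos _).ne']
    exact Real.log_le_log (Real.exp_pos _) h1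
  rw [abs_mul, abs_of_pos ht] at h3
  rw [show Real.log (2 * C) / t + t * s.card / 2 = (Real.log (2 * C) + t ^ 2 * s.card / 2) / t by
    field_simp, le_div_iff₀ ht]
  linarith

/-- Rounding towards zero: the absolute value does not grow, so that rounding both coordinates of a
point of the disc stays in the disc. -/
theorem exists_int_div_near {R : ℕ} (hR : 0 < R) {x : ℝ} (hx : |x| ≤ 1) :
    ∃ a ∈ Finset.Icc (-(R : ℤ)) R, |(a : ℝ) / R| ≤ |x| ∧ |x - a / R| ≤ 1 / R := by
  have hR' : (0 : ℝ) < R := by exact_mod_cast hR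
  have main : ∀ y : ℝ, 0 ≤ y → y ≤ 1 →
      ∃ a ∈ Finset.Icc (-(R : ℤ)) R, |(a : ℝ) / R| ≤ |y| ∧ |y - a / R| ≤ 1 / R := by
    intro y hy0 hy1
    have h0 : (0 : ℤ) ≤ ⌊y * R⌋ := Int.floor_nonneg.2 (by positivity)
    have h0' : (0 : ℝ) ≤ ⌊y * R⌋ := by exact_mod_cast h0
    have h1 := Int.floor_le (y * R)
    have h2 := Int.lt_floor_add_one (y * R)
    refine ⟨⌊y * R⌋, Finset.mem_Icc.2 ⟨by omega, ?_⟩, ?_, ?_⟩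
    · have : ((⌊y * R⌋ : ℤ) : ℝ) ≤ (R : ℤ) := by push_cast; nlinarith
      exact_mod_cast this
    · rw [abs_of_nonneg (by positivity), abs_of_nonneg hy0, div_le_iff₀ hR']
      exact h1
    · rw [abs_le, le_sub_iff_add_le, sub_le_iff_le_add, ← add_div, le_div_iff₀ hR']
      refine ⟨?_, by linarith⟩
      rw [← neg_div, ← add_div, div_le_iff₀ hR']
      linarith
  rcases le_total 0 x with h | h
  · exact main x h (abs_le.1 hx).2
  · obtain ⟨a, ha, h1, h2⟩ := main (-x) (by linarith) (by linarith [(abs_le.1 hx).1])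
    refine ⟨-a, ?_, ?_, ?_⟩
    · simp only [Finset.mem_Icc] at ha ⊢
      omega
    · simpa [neg_div, abs_neg] using h1
    · rw [← abs_neg]
      convert h2 using 2
      push_cast
      ring

/-- A finite net of the closed unit disc. -/
theorem exists_disc_net {R : ℕ} (hR : 0 < R) :
    ∃ G : Finset ℂ, G.card ≤ (2 * R + 1) ^ 2 ∧ (∀ w ∈ G, ‖w‖ ≤ 1) ∧
      ∀ z : ℂ, ‖z‖ ≤ 1 → ∃ w ∈ G, ‖z - w‖ ≤ 2 / R := by
  classical
  set I := Finset.Icc (-(R : ℤ)) R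
  refine ⟨((I ×ˢ I).image fun p => (⟨(p.1 : ℝ) / R, (p.2 : ℝ) / R⟩ : ℂ)).filter (‖·‖ ≤ 1),
    ?_, fun w hw => (Finset.mem_filter.1 hw).2, fun z hz => ?_⟩
  · refine (Finset.card_filter_le _ _).trans (Finset.card_image_le.trans ?_)
    rw [Finset.card_product, Int.card_Icc, sq]
    apply Nat.mul_le_mul <;> omega
  · obtain ⟨a, ha, ha1, ha2⟩ := exists_int_div_near hR ((Complex.abs_re_le_norm z).trans hz)
    obtain ⟨b, hb, hb1, hb2⟩ := exists_int_div_near hR ((Complex.abs_im_le_norm z).trans hz)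
    refine ⟨⟨(a : ℝ) / R, (b : ℝ) / R⟩, Finset.mem_filter.2 ⟨Finset.mem_image.2
      ⟨(a, b), Finset.mem_product.2 ⟨ha, hb⟩, rfl⟩, le_trans ?_ hz⟩, ?_⟩
    · rw [Complex.norm_def, Complex.norm_def]
      refine Real.sqrt_le_sqrt ?_
      rw [Complex.normSq_apply, Complex.normSq_apply]
      exact add_le_add (abs_le_iff_mul_self_le.1 ha1) (abs_le_iff_mul_self_le.1 hb1)
    · refine (Complex.norm_le_abs_re_add_abs_im _).trans ?_
      simp only [Complex.sub_re, Complex.sub_im]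
      calc _ ≤ (1 : ℝ) / R + 1 / R := add_le_add ha2 hb2
        _ = _ := by ring

theorem norm_prod_pow_le_one {ι : Type*} (s : Finset ι) (α : ι → ℕ) {z : ι → ℂ}
    (hz : ∀ j, ‖z j‖ ≤ 1) : ‖∏ j ∈ s, z j ^ α j‖ ≤ 1 := by
  rw [norm_prod]
  exact Finset.prod_le_one (fun _ _ => norm_nonneg _) fun j _ => by
    rw [norm_pow]; exact pow_le_one₀ (norm_nonneg _) (hz j)

theorem norm_pow_sub_pow_le {z w : ℂ} (hz : ‖z‖ ≤ 1) (hw : ‖w‖ ≤ 1) {e : ℝ} (h : ‖z - w‖ ≤ e)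
    (m : ℕ) : ‖z ^ m - w ^ m‖ ≤ m * e := by
  induction m with
  | zero => simp
  | succ m ih =>
    have he : 0 ≤ e := (norm_nonneg _).trans h
    calc ‖z ^ (m + 1) - w ^ (m + 1)‖ = ‖z ^ m * (z - w) + (z ^ m - w ^ m) * w‖ := by ring_nf
      _ ≤ ‖z ^ m‖ * ‖z - w‖ + ‖z ^ m - w ^ m‖ * ‖w‖ := by
          rw [← norm_mul, ← norm_mul]; exact norm_add_le _ _
      _ ≤ 1 * e + (m * e) * 1 := by
          gcongr
          rw [norm_pow]; exact pow_le_one₀ (norm_nonneg _) hz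
      _ = _ := by push_cast; ring

theorem norm_prod_pow_sub_prod_pow_le {ι : Type*} (s : Finset ι) (α : ι → ℕ) {z w : ι → ℂ}
    (hz : ∀ j, ‖z j‖ ≤ 1) (hw : ∀ j, ‖w j‖ ≤ 1) {e : ℝ} (h : ∀ j, ‖z j - w j‖ ≤ e) :
    ‖∏ j ∈ s, z j ^ α j - ∏ j ∈ s, w j ^ α j‖ ≤ (∑ j ∈ s, α j : ℕ) * e := by
  classical
  induction s using Finset.induction_on with
  | empty => simp
  | insert i s hi ih =>
    have he : 0 ≤ e := (norm_nonneg _).trans (h i)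
    rw [Finset.prod_insert hi, Finset.prod_insert hi, Finset.sum_insert hi]
    set P := ∏ j ∈ s, z j ^ α j
    set P' := ∏ j ∈ s, w j ^ α j
    calc ‖z i ^ α i * P - w i ^ α i * P'‖
        = ‖z i ^ α i * (P - P') + (z i ^ α i - w i ^ α i) * P'‖ := by ring_nf
      _ ≤ ‖z i ^ α i‖ * ‖P - P'‖ + ‖z i ^ α i - w i ^ α i‖ * ‖P'‖ := by
          rw [← norm_mul, ← norm_mul]; exact norm_add_le _ _
      _ ≤ 1 * ((∑ j ∈ s, α j : ℕ) * e) + (α i * e) * 1 := by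
          gcongr
          · rw [norm_pow]; exact pow_le_one₀ (norm_nonneg _) (hz i)
          · exact norm_pow_sub_pow_le (hz i) (hw i) (h i) _
          · exact norm_prod_pow_le_one s α hw
      _ = _ := by push_cast; ring

/-- A Kahane-Salem-Zygmund inequality for a finite family of sets of monomials. -/
theorem exists_signs_norm_sum_le {n k : ℕ} (S : Finset (Fin n →₀ ℕ))
    (hS : ∀ α ∈ S, ∑ j, α j = k) (F : Finset (Finset (Fin n →₀ ℕ))) (hF : ∀ T ∈ F, T ⊆ S)
    {R : ℕ} (hR : 0 < R) {t : ℝ} (ht : 0 < t) :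
    ∃ ε : (Fin n →₀ ℕ) → ℝ, (∀ α, ε α = 1 ∨ ε α = -1) ∧
      ∀ T ∈ F, ∀ z : Fin n → ℂ, (∀ j, ‖z j‖ ≤ 1) →
        ‖∑ α ∈ T, (ε α : ℂ) * ∏ j, z j ^ α j‖ ≤
          2 * (Real.log (4 * F.card * (2 * R + 1) ^ (2 * n)) / t + t * S.card / 2) +
            S.card * (k * (2 / R)) := by
  classical
  obtain ⟨G, hGc, hG1, hG2⟩ := exists_disc_net hR
  let V := F ×ˢ (Fintype.piFinset fun _ : Fin n => G) ×ˢ (Finset.univ : Finset Bool)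
  -- Setting the entry to `0` off `v.1` lets one choice of signs serve all `T ∈ F`. The Boolean
  -- selects real or imaginary part, and the guard `v ∈ V` makes the bound by `1` hold for every
  -- `v`.
  let x : Finset (Fin n →₀ ℕ) × (Fin n → ℂ) × Bool → (Fin n →₀ ℕ) → ℝ := fun v α =>
    if v ∈ V ∧ α ∈ v.1 then
      (if v.2.2 then (∏ j, v.2.1 j ^ α j).re else (∏ j, v.2.1 j ^ α j).im) else 0
  have hx : ∀ v α, |x v α| ≤ 1 := by
    intro v α
    by_cases hv : v ∈ V ∧ α ∈ v.1
    · have hw : ∀ j, ‖v.2.1 j‖ ≤ 1 := fun j => hG1 _ (Fintype.mem_piFinset.1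
        (Finset.mem_product.1 (Finset.mem_product.1 hv.1).2).1 j)
      have h1 := norm_prod_pow_le_one Finset.univ α hw
      simp only [x, if_pos hv]
      split_ifs
      · exact (Complex.abs_re_le_norm _).trans h1
      · exact (Complex.abs_im_le_norm _).trans h1
    · simp [x, if_neg hv]
  have hV : (V.card : ℝ) ≤ 2 * F.card * (2 * R + 1) ^ (2 * n) := by
    have h1 : V.card = F.card * (G.card ^ n * 2) := by
      simp [V, Finset.card_product, Fintype.card_piFinset]
    have h2 : V.card ≤ 2 * F.card * (2 * R + 1) ^ (2 * n) := by
      rw [h1, pow_mul]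
      calc F.card * (G.card ^ n * 2) ≤ F.card * (((2 * R + 1) ^ 2) ^ n * 2) := by gcongr
        _ = _ := by ring
    exact_mod_cast h2
  obtain ⟨ε, hε, hεV⟩ := exists_signs_abs_sum_le S V x hx hV ht
  refine ⟨ε, hε, fun T hT z hz => ?_⟩
  choose w hwG hw using fun j => hG2 (z j) (hz j)
  have hw1 : ∀ j, ‖w j‖ ≤ 1 := fun j => hG1 _ (hwG j)
  have hmem : ∀ b : Bool, (T, w, b) ∈ V := fun b => Finset.mem_product.2
    ⟨hT, Finset.mem_product.2 ⟨Fintype.mem_piFinset.2 hwG, Finset.mem_univ _⟩⟩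
  have hεn : ∀ α, ‖(ε α : ℂ)‖ = 1 := fun α => by rcases hε α with h | h <;> simp [h]
  have hlog : 2 * (2 * F.card * (2 * R + 1) ^ (2 * n) : ℝ) =
      4 * F.card * (2 * R + 1) ^ (2 * n) := by ring
  rw [hlog] at hεV
  have hre : |(∑ α ∈ T, (ε α : ℂ) * ∏ j, w j ^ α j).re| ≤
      Real.log (4 * F.card * (2 * R + 1) ^ (2 * n)) / t + t * S.card / 2 := by
    refine le_of_eq_of_le ?_ (hεV _ (hmem true))
    rw [Complex.re_sum, ← Finset.sum_subset (hF T hT)]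
    · congr 1
      refine Finset.sum_congr rfl fun α hα => ?_
      simp [x, hmem true, hα]
    · intro α _ hα
      simp [x, hα]
  have him : |(∑ α ∈ T, (ε α : ℂ) * ∏ j, w j ^ α j).im| ≤
      Real.log (4 * F.card * (2 * R + 1) ^ (2 * n)) / t + t * S.card / 2 := by
    refine le_of_eq_of_le ?_ (hεV _ (hmem false))
    rw [Complex.im_sum, ← Finset.sum_subset (hF T hT)]
    · congr 1
      refine Finset.sum_congr rfl fun α hα => ?_
      simp [x, hmem false, hα]
    · intro α _ hα
      simp [x, hα]
  have hdiff : ‖∑ α ∈ T, (ε α : ℂ) * ∏ j, z j ^ α j - ∑ α ∈ T, (ε α : ℂ) * ∏ j, w j ^ α j‖ ≤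
      S.card * (k * (2 / R)) := by
    rw [← Finset.sum_sub_distrib]
    calc _ ≤ ∑ α ∈ T, (k * (2 / R) : ℝ) := by
          refine norm_sum_le_of_le _ fun α hα => ?_
          rw [← mul_sub, norm_mul, hεn, one_mul, ← hS α (hF T hT hα)]
          exact norm_prod_pow_sub_prod_pow_le _ _ hz hw1 hw
      _ = T.card * (k * (2 / R)) := by rw [Finset.sum_const, nsmul_eq_mul]
      _ ≤ _ := by
          gcongr
          exact hF T hT
  have htri := norm_le_norm_sub_add (∑ α ∈ T, (ε α : ℂ) * ∏ j, z j ^ α j)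
    (∑ α ∈ T, (ε α : ℂ) * ∏ j, w j ^ α j)
  have := Complex.norm_le_abs_re_add_abs_im (∑ α ∈ T, (ε α : ℂ) * ∏ j, w j ^ α j)
  linarith

/-! ### Counting monomials and choosing the parameters -/

theorem mem_monomials {n k : ℕ} {α : Fin n →₀ ℕ} :
    α ∈ Finset.finsuppAntidiag (Finset.univ : Finset (Fin n)) k ↔ α.degree = k := by
  simp [Finset.mem_finsuppAntidiag, Finsupp.degree_eq_sum]

theorem sq_le_two_mul_factorial (k : ℕ) : k ^ 2 ≤ 2 * k.factorial := by
  rcases Nat.lt_or_ge k 2 with h | h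
  · interval_cases k <;> simp
  · induction k, h using Nat.le_induction with
    | base => decide
    | succ k hk ih =>
      rw [Nat.factorial_succ]
      nlinarith

theorem mul_pred_le_two_mul_two_pow (k : ℕ) : k * (k - 1) ≤ 2 * 2 ^ k := by
  have h : k.choose 2 ≤ 2 ^ k := Nat.choose_le_two_pow k 2
  have := Nat.choose_two_right k
  have h2 : 2 ∣ k * (k - 1) := (Nat.even_mul_pred_self k).two_dvd
  omega

/-- The count is at most `(n + k - 1)^k / k!` with `n = 2^k`. Here `(1 + (k - 1)/n)^k ≤ e² < 8`, and
`k!` absorbs `k² / 2`. The saved `k²` later cancels the `k²` in the logarithm of the net size. -/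
theorem card_monomials_mul_sq_le (k : ℕ) (hk : 1 ≤ k) :
    ((Finset.finsuppAntidiag (Finset.univ : Finset (Fin (2 ^ k))) k).card : ℝ) * k ^ 2 ≤
      16 * (2 ^ k) ^ k := by
  rw [Finset.card_finsuppAntidiag_nat_eq_choose, Finset.card_univ, Fintype.card_fin]
  have hf : (0 : ℝ) < k.factorial := by exact_mod_cast k.factorial_pos
  have h1 : ((2 ^ k + k - 1 : ℕ) : ℝ) ^ k ≤ (2 ^ k) ^ k * 8 := by
    have h2 : ((2 ^ k + k - 1 : ℕ) : ℝ) = 2 ^ k * (((k - 1 : ℕ) : ℝ) / 2 ^ k + 1) := by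
      rw [Nat.add_sub_assoc hk]
      push_cast
      field_simp
      ring
    rw [h2, mul_pow]
    gcongr
    have h3 : (k : ℝ) * (((k - 1 : ℕ) : ℝ) / 2 ^ k) ≤ 2 := by
      rw [← mul_div_assoc, div_le_iff₀ (by positivity)]
      exact_mod_cast mul_pred_le_two_mul_two_pow k
    calc (((k - 1 : ℕ) : ℝ) / 2 ^ k + 1) ^ k ≤ Real.exp (((k - 1 : ℕ) : ℝ) / 2 ^ k) ^ k := by
          gcongr; exact Real.add_one_le_exp _
      _ = Real.exp (k * (((k - 1 : ℕ) : ℝ) / 2 ^ k)) := by rw [Real.exp_nat_mul]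
      _ ≤ Real.exp (2 : ℕ) := Real.exp_le_exp.2 (by exact_mod_cast h3)
      _ = Real.exp 1 ^ 2 := by rw [← Real.exp_nat_mul, mul_one]
      _ ≤ 2.7182818286 ^ 2 := by gcongr; exact Real.exp_one_lt_d9.le
      _ ≤ 8 := by norm_num
  have h4 : ((k ^ 2 : ℕ) : ℝ) ≤ (2 * k.factorial : ℕ) := by exact_mod_cast sq_le_two_mul_factorial k
  push_cast at h4
  calc _ ≤ ((2 ^ k + k - 1 : ℕ) : ℝ) ^ k / k.factorial * (2 * k.factorial) := by
        gcongr
        exact Nat.choose_le_pow_div _ _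
    _ = 2 * ((2 ^ k + k - 1 : ℕ) : ℝ) ^ k := by field_simp
    _ ≤ 2 * ((2 ^ k) ^ k * 8) := by gcongr
    _ = _ := by ring

theorem pow_le_factorial_mul_card_monomials (n k : ℕ) :
    n ^ k ≤ k.factorial * (Finset.finsuppAntidiag (Finset.univ : Finset (Fin n)) k).card := by
  rw [Finset.card_finsuppAntidiag_nat_eq_choose, Finset.card_univ, Fintype.card_fin,
    ← Nat.ascFactorial_eq_factorial_mul_choose']
  exact Nat.pow_succ_le_ascFactorial n k

/-- Signs for which all truncations, with respect to the size of a weight `w`, of the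
polynomial of degree `k` in `2 ^ k` variables are small. -/
theorem exists_signs_truncations_le {k : ℕ} (hk : 2 ≤ k) (w : (Fin (2 ^ k) →₀ ℕ) → ℕ) :
    ∃ ε : (Fin (2 ^ k) →₀ ℕ) → ℝ, (∀ α, ε α = 1 ∨ ε α = -1) ∧
      ∀ (N : ℕ) (z : Fin (2 ^ k) → ℂ), (∀ j, ‖z j‖ ≤ 1) →
        ‖∑ α ∈ (Finset.finsuppAntidiag Finset.univ k).filter (w · ≤ N),
            (ε α : ℂ) * ∏ j, z j ^ α j‖ ≤
          62 * ((2 ^ k : ℕ) : ℝ) ^ (((k : ℝ) + 1) / 2) := by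
  classical
  set S := Finset.finsuppAntidiag (Finset.univ : Finset (Fin (2 ^ k))) k with hSdef
  -- A nonempty truncation is determined by the largest weight it retains, so at most `S.card` sets
  -- have to be controlled.
  set F := S.image fun β => S.filter (w · ≤ w β)
  set n : ℝ := ((2 ^ k : ℕ) : ℝ) with hn
  have hn1 : 1 ≤ n := by rw [hn]; exact_mod_cast Nat.one_le_two_pow
  have hn0 : 0 < n := by linarith
  have hk' : (2 : ℝ) ≤ k := by exact_mod_cast hk
  set r : ℝ := n ^ (((k : ℝ) + 1) / 2) with hr
  have hr1 : 1 ≤ r := Real.one_le_rpow hn1 (by positivity)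
  set q : ℝ := n ^ ((1 - (k : ℝ)) / 2) with hq
  have hq0 : 0 < q := Real.rpow_pos_of_pos hn0 _
  have hrq : r * q = n := by
    rw [hr, hq, ← Real.rpow_add hn0]
    ring_nf
    exact Real.rpow_one _
  have hqn : q * n ^ k = r := by
    rw [hr, hq, ← Real.rpow_natCast, ← Real.rpow_add hn0]
    ring_nf
  have hM : (S.card : ℝ) * k ^ 2 ≤ 16 * n ^ k := by
    rw [hn]; push_cast; exact card_monomials_mul_sq_le k (by omega)
  -- `R = n^k` makes the discretisation error bounded while the logarithm stays at most `7 n k²`.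
  -- With `t = k² q` the logarithmic and quadratic terms become at most `7 r` and `8 r`; the total
  -- is `2 (7 + 8) + 32 = 62` times `r`.
  obtain ⟨ε, hε, h⟩ := exists_signs_norm_sum_le S
    (fun α hα => by rw [← Finsupp.degree_eq_sum]; exact mem_monomials.1 hα) F
    (by
      intro T hT
      obtain ⟨β, _, rfl⟩ := Finset.mem_image.1 hT
      exact Finset.filter_subset _ _)
    (R := (2 ^ k) ^ k) (by positivity) (t := k ^ 2 * q) (by positivity)
  refine ⟨ε, hε, fun N z hz => ?_⟩
  rcases (S.filter (w · ≤ N)).eq_empty_or_nonempty with he | hne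
  · rw [he]; simp only [Finset.sum_empty, norm_zero]; positivity
  obtain ⟨β, hβ, hmax⟩ := Finset.exists_max_image _ w hne
  have hβ' := Finset.mem_filter.1 hβ
  have hT : S.filter (w · ≤ N) ∈ F := by
    refine Finset.mem_image.2 ⟨β, hβ'.1, ?_⟩
    ext α
    simp only [Finset.mem_filter]
    constructor
    · exact fun hα => ⟨hα.1, hα.2.trans hβ'.2⟩
    · exact fun hα => ⟨hα.1, hmax α (Finset.mem_filter.2 hα)⟩
  refine (h _ hT z hz).trans ?_
  have hFpos : 0 < F.card := Finset.card_pos.2 ⟨_, hT⟩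
  have hlog : Real.log (4 * F.card * (2 * (((2 ^ k) ^ k : ℕ) : ℝ) + 1) ^ (2 * 2 ^ k)) ≤
      7 * n * k ^ 2 := by
    have h1 : (F.card : ℝ) ≤ 4 * n ^ k := by
      have h2 : (F.card : ℝ) ≤ S.card := by exact_mod_cast Finset.card_image_le
      have h3 : (0 : ℝ) ≤ S.card := Nat.cast_nonneg _
      nlinarith [mul_le_mul_of_nonneg_left (by nlinarith : (4 : ℝ) ≤ k ^ 2) h3]
    have h4 : (1 : ℝ) ≤ (2 ^ k) ^ k := one_le_pow₀ (one_le_pow₀ (by norm_num))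
    have h5 : 4 * F.card * (2 * (((2 ^ k) ^ k : ℕ) : ℝ) + 1) ^ (2 * 2 ^ k) ≤
        (2 : ℝ) ^ (4 + k ^ 2 + (2 + k ^ 2) * (2 * 2 ^ k)) := by
      calc _ ≤ 4 * (4 * n ^ k) * (4 * (2 ^ k) ^ k) ^ (2 * 2 ^ k) := by
            push_cast
            gcongr
            linarith
        _ = _ := by
            have h6 : (4 : ℝ) * (2 ^ k) ^ k = 2 ^ (2 + k ^ 2) := by
              rw [← pow_mul, pow_add, sq k]; norm_num
            rw [h6, ← pow_mul, hn, pow_add, pow_add, sq k, pow_mul 2 k k]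
            push_cast
            ring
    calc _ ≤ Real.log ((2 : ℝ) ^ (4 + k ^ 2 + (2 + k ^ 2) * (2 * 2 ^ k))) :=
          Real.log_le_log (by positivity) h5
      _ = (4 + k ^ 2 + (2 + k ^ 2) * (2 * n)) * Real.log 2 := by
          rw [Real.log_pow, hn]; push_cast; ring
      _ ≤ (4 + k ^ 2 + (2 + k ^ 2) * (2 * n)) * 1 := by
          gcongr
          linarith [Real.log_two_lt_d9]
      _ ≤ _ := by
          have h7 : (4 : ℝ) ≤ k ^ 2 := by nlinarith
          have h8 : (k : ℝ) ^ 2 ≤ n * k ^ 2 := le_mul_of_one_le_left (by positivity) hn1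
          have h9 : n * 4 ≤ n * k ^ 2 := mul_le_mul_of_nonneg_left h7 hn0.le
          linarith
  have e1 : Real.log (4 * F.card * (2 * (((2 ^ k) ^ k : ℕ) : ℝ) + 1) ^ (2 * 2 ^ k)) /
      (k ^ 2 * q) ≤ 7 * r := by
    rw [div_le_iff₀ (by positivity)]
    refine hlog.trans_eq ?_
    rw [← hrq]
    ring
  have e2 : (k : ℝ) ^ 2 * q * S.card / 2 ≤ 8 * r := by
    rw [← hqn]
    nlinarith
  have e3 : (S.card : ℝ) * (k * (2 / (((2 ^ k) ^ k : ℕ) : ℝ))) ≤ 32 * r := by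
    have h6 : (((2 ^ k) ^ k : ℕ) : ℝ) = n ^ k := by rw [hn]; push_cast; ring
    have h7 : (0 : ℝ) < n ^ k := by positivity
    have h8 : (S.card : ℝ) * (k * 2) ≤ 32 * n ^ k := by
      have h3 : (0 : ℝ) ≤ S.card := Nat.cast_nonneg _
      nlinarith [mul_nonneg h3 (by nlinarith : (0 : ℝ) ≤ k ^ 2 - k)]
    calc (S.card : ℝ) * (k * (2 / (((2 ^ k) ^ k : ℕ) : ℝ))) = S.card * (k * 2) / n ^ k := by
          rw [h6]; ring
      _ ≤ 32 := by rw [div_le_iff₀ h7]; exact h8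
      _ ≤ 32 * r := by linarith
  linarith

/-! ### Blocks of primes and unique factorization -/

theorem blockPrime_prime (k : ℕ) (j : Fin (2 ^ k)) : (blockPrime k j).Prime :=
  Nat.prime_nth_prime _

theorem blockPrime_eq_iff {k l : ℕ} {i : Fin (2 ^ k)} {j : Fin (2 ^ l)} :
    blockPrime k i = blockPrime l j ↔ 2 ^ k + (i : ℕ) = 2 ^ l + (j : ℕ) := by
  have h1 := Nat.one_le_two_pow (n := k)
  have h2 := Nat.one_le_two_pow (n := l)
  rw [blockPrime, blockPrime, (Nat.nth_injective Nat.infinite_setOfPred_prime).eq_iff]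
  omega

theorem blockPrime_injective (k : ℕ) : Function.Injective (blockPrime k) := fun i j h => by
  have := blockPrime_eq_iff.1 h
  exact Fin.ext (by omega)

/-- The index ranges `[2^k, 2^(k+1))` are disjoint. -/
theorem eq_of_blockPrime_eq {k l : ℕ} {i : Fin (2 ^ k)} {j : Fin (2 ^ l)}
    (h : blockPrime k i = blockPrime l j) : k = l := by
  have h0 := blockPrime_eq_iff.1 h
  have hi := i.2
  have hj := j.2
  rcases lt_trichotomy k l with h1 | h1 | h1
  · have := Nat.pow_le_pow_right (n := 2) (by norm_num) (Nat.succ_le_of_lt h1)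
    rw [Nat.pow_succ] at this
    omega
  · exact h1
  · have := Nat.pow_le_pow_right (n := 2) (by norm_num) (Nat.succ_le_of_lt h1)
    rw [Nat.pow_succ] at this
    omega

theorem two_pow_le_blockPrime (k : ℕ) (j : Fin (2 ^ k)) : 2 ^ k ≤ blockPrime k j := by
  have := Nat.add_two_le_nth_prime (2 ^ k - 1 + (j : ℕ))
  rw [blockPrime]
  omega

theorem blockInt_ne_zero (k : ℕ) (α : Fin (2 ^ k) →₀ ℕ) : blockInt k α ≠ 0 :=
  Finset.prod_ne_zero_iff.2 fun j _ => pow_ne_zero _ (blockPrime_prime k j).ne_zero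

theorem factorization_blockInt (k : ℕ) (α : Fin (2 ^ k) →₀ ℕ) (j : Fin (2 ^ k)) :
    (blockInt k α).factorization (blockPrime k j) = α j := by
  rw [blockInt, Nat.factorization_prod_apply
    fun i _ => pow_ne_zero _ (blockPrime_prime k i).ne_zero, Finset.sum_eq_single j]
  · simp [(blockPrime_prime k j).factorization_self]
  · intro i _ hi
    rw [(blockPrime_prime k i).factorization_pow]
    exact Finsupp.single_eq_of_ne fun h => hi (blockPrime_injective k h.symm)
  · simp

theorem blockInt_injective (k : ℕ) : Function.Injective (blockInt k) := fun α β h => by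
  ext j
  rw [← factorization_blockInt, h, factorization_blockInt]

theorem eq_of_blockInt_eq {k l : ℕ} {α : Fin (2 ^ k) →₀ ℕ} {β : Fin (2 ^ l) →₀ ℕ} (hα : α ≠ 0)
    (h : blockInt k α = blockInt l β) : k = l := by
  obtain ⟨j, hj⟩ := Finsupp.ne_iff.1 hα
  have h1 : blockPrime k j ∣ blockInt l β := by
    rw [← h]
    exact (dvd_pow_self _ hj).trans (Finset.dvd_prod_of_mem _ (Finset.mem_univ j))
  obtain ⟨i, _, hi⟩ := (blockPrime_prime k j).prime.exists_mem_finset_dvd h1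
  exact eq_of_blockPrime_eq ((Nat.prime_dvd_prime_iff_eq (blockPrime_prime k j)
    (blockPrime_prime l i)).1 ((blockPrime_prime k j).dvd_of_dvd_pow hi))

theorem mem_block {k n : ℕ} : n ∈ block k ↔ ∃ α : Fin (2 ^ k) →₀ ℕ, α.degree = k ∧
    blockInt k α = n := by
  simp only [block, Finset.mem_image, mem_monomials]

theorem disjoint_block {k l : ℕ} (hk : 2 ≤ k) (hkl : k ≠ l) : Disjoint (block k) (block l) := by
  refine Finset.disjoint_left.2 fun n hn hn' => hkl ?_
  obtain ⟨α, hα, rfl⟩ := mem_block.1 hn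
  obtain ⟨β, _, h⟩ := mem_block.1 hn'
  refine eq_of_blockInt_eq ?_ h.symm
  rintro rfl
  simp at hα
  omega

/-- Unique factorization recovers both `k` and the exponents from the integer, so the prescriptions
do not conflict. -/
theorem exists_isAssembledFrom (Q : (k : ℕ) → MvPolynomial (Fin (2 ^ k)) ℂ) :
    ∃ a : ℕ → ℂ, IsAssembledFrom a Q := by
  classical
  refine ⟨fun n => if h : ∃ k : ℕ, 2 ≤ k ∧ n ∈ block k then
    (Q h.choose).coeff (mem_block.1 h.choose_spec.2).choose else 0, fun k hk α hα => ?_,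
    fun n hn => dif_neg fun ⟨k, hk, h⟩ => hn k hk h⟩
  have h : ∃ l : ℕ, 2 ≤ l ∧ blockInt k α ∈ block l := ⟨k, hk, mem_block.2 ⟨α, hα, rfl⟩⟩
  beta_reduce
  rw [dif_pos h]
  have aux : ∀ (l : ℕ) (β : Fin (2 ^ l) →₀ ℕ), blockInt l β = blockInt k α →
      (Q l).coeff β = (Q k).coeff α := by
    intro l β hβ
    obtain rfl : k = l := by
      refine eq_of_blockInt_eq ?_ hβ.symm
      rintro rfl
      simp at hα
      omega
    rw [blockInt_injective k hβ]
  exact aux _ _ (mem_block.1 h.choose_spec.2).choose_spec.2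

theorem blockInt_cpow (k : ℕ) (α : Fin (2 ^ k) →₀ ℕ) (s : ℂ) :
    (blockInt k α : ℂ) ^ s = ∏ j, ((blockPrime k j : ℂ) ^ s) ^ α j := by
  rw [blockInt]
  induction (Finset.univ : Finset (Fin (2 ^ k))) using Finset.induction_on with
  | empty => simp
  | insert i t hi ih =>
    rw [Finset.prod_insert hi, Finset.prod_insert hi, Nat.cast_mul,
      Complex.natCast_mul_natCast_cpow, ih, Nat.cast_pow, ← Complex.natCast_cpow_natCast_mul,
      mul_comm _ s, Complex.cpow_mul_nat]

theorem term_blockInt (a : ℕ → ℂ) (k : ℕ) (α : Fin (2 ^ k) →₀ ℕ) (s : ℂ) :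
    LSeries.term a s (blockInt k α) =
      a (blockInt k α) * ∏ j, ((blockPrime k j : ℂ) ^ (-s)) ^ α j := by
  rw [LSeries.term_of_ne_zero (blockInt_ne_zero k α), ← blockInt_cpow, Complex.cpow_neg,
    div_eq_mul_inv]

theorem sum_block_term {a : ℕ → ℂ} {Q : (k : ℕ) → MvPolynomial (Fin (2 ^ k)) ℂ}
    (ha : IsAssembledFrom a Q) {k : ℕ} (hk : 2 ≤ k) (p : ℕ → Prop) [DecidablePred p] (s : ℂ) :
    ∑ n ∈ (block k).filter p, LSeries.term a s n =
      ∑ α ∈ (Finset.finsuppAntidiag Finset.univ k).filter (p <| blockInt k ·),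
        (Q k).coeff α * ∏ j, ((blockPrime k j : ℂ) ^ (-s)) ^ α j := by
  rw [block, Finset.filter_image, Finset.sum_image (blockInt_injective k).injOn]
  refine Finset.sum_congr rfl fun α hα => ?_
  rw [term_blockInt, ha.1 k hk α (mem_monomials.1 (Finset.mem_filter.1 hα).1)]

/-! ### Bessel's inequality and the upper bound for the strip -/

theorem tendsto_average_pow {w : ℂ} (hw : ‖w‖ = 1) :
    Tendsto (fun J : ℕ => (∑ j ∈ Finset.range J, w ^ j) / J) atTop (nhds (if w = 1 then 1 else 0)) := by
  split_ifs with h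
  · refine tendsto_const_nhds.congr' ?_
    filter_upwards [eventually_gt_atTop 0] with J hJ
    have : (J : ℂ) ≠ 0 := by exact_mod_cast hJ.ne'
    simp [h, this]
  · refine squeeze_zero_norm (a := fun J : ℕ => 2 / ‖w - 1‖ / J) (fun J => ?_)
      (tendsto_const_div_atTop_nhds_zero_nat _)
    rw [geom_sum_eq h, norm_div, norm_div, Complex.norm_natCast]
    gcongr
    refine (norm_sub_le _ _).trans_eq ?_
    rw [norm_pow, hw]
    norm_num

/-- Bessel's inequality for the means of sums of exponentials over the integers. -/
theorem sum_sq_norm_le_of_norm_sum_pow_le {ι : Type*} (s : Finset ι) (c z : ι → ℂ)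
    (hz : ∀ n, ‖z n‖ = 1) (hinj : Set.InjOn z s) {C : ℝ}
    (h : ∀ j : ℕ, ‖∑ n ∈ s, c n * z n ^ j‖ ≤ C) : ∑ n ∈ s, ‖c n‖ ^ 2 ≤ C ^ 2 := by
  -- The mean of `|∑ c_n z_n^j|²` over `j < J`, expanded as a double sum; only the diagonal survives
  -- as `J → ∞`.
  have hlim : Tendsto (fun J : ℕ =>
      (∑ n ∈ s, ∑ m ∈ s, c n * star (c m) *
        ((∑ j ∈ Finset.range J, (z n * star (z m)) ^ j) / J))) atTop
      (nhds (∑ n ∈ s, ∑ m ∈ s, c n * star (c m) * (if z n * star (z m) = 1 then 1 else 0))) :=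
    tendsto_finsetSum _ fun n _ => tendsto_finsetSum _ fun m _ =>
      (tendsto_average_pow (by rw [norm_mul, norm_star, hz, hz, one_mul])).const_mul _
  have hval : ∑ n ∈ s, ∑ m ∈ s, c n * star (c m) * (if z n * star (z m) = 1 then 1 else 0) =
      ((∑ n ∈ s, ‖c n‖ ^ 2 : ℝ) : ℂ) := by
    rw [Complex.ofReal_sum]
    refine Finset.sum_congr rfl fun n hn => ?_
    rw [Finset.sum_eq_single n]
    · rw [if_pos, mul_one, Complex.star_def, Complex.mul_conj, Complex.normSq_eq_norm_sq]
      rw [Complex.star_def, Complex.mul_conj, Complex.normSq_eq_norm_sq, hz]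
      simp
    · intro m hm hmn
      rw [if_neg, mul_zero]
      intro h1
      refine hmn (hinj hm hn ?_)
      calc z m = z n * star (z m) * z m := by rw [h1, one_mul]
        _ = z n * (z m * star (z m)) := by ring
        _ = z n := by
          rw [Complex.star_def, Complex.mul_conj, Complex.normSq_eq_norm_sq, hz]
          simp
    · exact fun h => absurd hn h
  rw [hval] at hlim
  have hnorm := hlim.norm
  rw [Complex.norm_real, Real.norm_of_nonneg (by positivity)] at hnorm
  refine le_of_tendsto hnorm ?_
  filter_upwards [eventually_gt_atTop 0] with J hJ
  have hJ' : (0 : ℝ) < J := by exact_mod_cast hJ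
  have hexp : (∑ n ∈ s, ∑ m ∈ s, c n * star (c m) *
        ((∑ j ∈ Finset.range J, (z n * star (z m)) ^ j) / J)) =
      (∑ j ∈ Finset.range J, (∑ n ∈ s, c n * z n ^ j) * star (∑ n ∈ s, c n * z n ^ j)) / J := by
    simp_rw [star_sum, Finset.sum_mul_sum, Finset.sum_div, Finset.mul_sum]
    rw [Finset.sum_comm' (t' := s) (s' := fun _ => Finset.range J) (by simp)]
    refine Finset.sum_congr rfl fun n _ => ?_
    rw [Finset.sum_comm]
    refine Finset.sum_congr rfl fun j _ => Finset.sum_congr rfl fun m _ => ?_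
    rw [star_mul', star_pow, mul_pow]
    ring
  rw [hexp, norm_div, Complex.norm_natCast, div_le_iff₀ hJ']
  calc _ ≤ ∑ j ∈ Finset.range J, C ^ 2 := by
        refine norm_sum_le_of_le _ fun j _ => ?_
        rw [norm_mul, norm_star, ← sq]
        exact pow_le_pow_left₀ (norm_nonneg _) (h j) 2
    _ = C ^ 2 * J := by rw [Finset.sum_const, Finset.card_range, nsmul_eq_mul, mul_comm]

theorem partialSum_bounded {a : ℕ → ℂ} {x : ℝ} (h : ConvergesUniformlyOn a {s : ℂ | x ≤ s.re}) :
    ∃ (C : ℝ) (N₀ : ℕ), ∀ N ≥ N₀, ∀ s : ℂ, s.re = x → ‖partialSum a N s‖ ≤ C := by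
  obtain ⟨f, hf⟩ := h
  obtain ⟨N₀, hN₀⟩ := eventually_atTop.1 (Metric.tendstoUniformlyOn_iff.1 hf 1 one_pos)
  refine ⟨∑ n ∈ Finset.Icc 1 N₀, ‖LSeries.term a x n‖ + 1 + 1, N₀, fun N hN s hs => ?_⟩
  have h1 := hN₀ N hN s hs.ge
  have h2 := hN₀ N₀ le_rfl s hs.ge
  rw [dist_comm, dist_eq_norm] at h1
  rw [dist_eq_norm] at h2
  have h3 : ‖partialSum a N₀ s‖ ≤ ∑ n ∈ Finset.Icc 1 N₀, ‖LSeries.term a x n‖ :=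
    norm_sum_le_of_le _ fun n _ => LSeries.norm_term_le_of_re_le_re a (by simp [hs]) n
  calc ‖partialSum a N s‖
      = ‖partialSum a N₀ s + (f s - partialSum a N₀ s) + (partialSum a N s - f s)‖ := by ring_nf
    _ ≤ _ := norm_add₃_le
    _ ≤ _ := by gcongr

theorem sum_sq_norm_term_le {a : ℕ → ℂ} {x C : ℝ} {N : ℕ}
    (h : ∀ s : ℂ, s.re = x → ‖partialSum a N s‖ ≤ C) :
    ∑ n ∈ Finset.Icc 1 N, ‖LSeries.term a x n‖ ^ 2 ≤ C ^ 2 := by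
  rcases Nat.eq_zero_or_pos N with rfl | hN
  · simpa using sq_nonneg C
  have hN' : (0 : ℝ) < N := by exact_mod_cast hN
  -- The line is sampled at heights `j / N`. The frequencies `log n / N` lie in `[0, 1]`, an
  -- interval shorter than `2π`, so distinct `n` give distinct points of the circle.
  refine sum_sq_norm_le_of_norm_sum_pow_le (Finset.Icc 1 N) (LSeries.term a x)
    (fun n => Complex.exp ((-(Real.log n / N) : ℝ) * Complex.I))
    (fun n => Complex.norm_exp_ofReal_mul_I _) ?_ fun j => ?_
  · have hb : ∀ n ∈ Finset.Icc 1 N, 0 ≤ Real.log n / N ∧ Real.log n / N ≤ 1 := by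
      intro n hn
      have hn' := Finset.mem_Icc.1 hn
      refine ⟨div_nonneg (Real.log_nonneg (by exact_mod_cast hn'.1)) hN'.le, ?_⟩
      rw [div_le_one hN']
      exact (Real.log_le_self (Nat.cast_nonneg _)).trans (by exact_mod_cast hn'.2)
    intro n hn m hm hnm
    have hn1 := hb n hn
    have hm1 := hb m hm
    have hpi := Real.pi_gt_three
    have him : ∀ t : ℝ, ((t : ℂ) * Complex.I).im = t := fun t => by
      rw [Complex.im_ofReal_mul, Complex.I_im, mul_one]
    have h1 := Complex.exp_inj_of_neg_pi_lt_of_le_pi (by rw [him]; linarith)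
      (by rw [him]; linarith) (by rw [him]; linarith) (by rw [him]; linarith) hnm
    have h2 : Real.log n / N = Real.log m / N := by
      have := congrArg Complex.im h1
      rw [him, him] at this
      linarith
    have h3 : Real.log n = Real.log m := by field_simp at h2; exact h2
    have := Real.log_injOn_pos (Set.mem_Ioi.2 (by exact_mod_cast (Finset.mem_Icc.1 hn).1))
      (Set.mem_Ioi.2 (by exact_mod_cast (Finset.mem_Icc.1 hm).1)) h3
    exact_mod_cast this
  · refine le_of_eq_of_le ?_ (h (x + (j / N : ℝ) * Complex.I) (by simp))
    rw [partialSum]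
    congr 1
    refine Finset.sum_congr rfl fun n hn => ?_
    have hn0 : n ≠ 0 := by have := (Finset.mem_Icc.1 hn).1; omega
    have hn0' : (n : ℂ) ≠ 0 := by exact_mod_cast hn0
    rw [LSeries.term_of_ne_zero hn0, LSeries.term_of_ne_zero hn0, Complex.cpow_add _ _ hn0',
      div_mul_eq_div_div, div_eq_mul_inv _ ((n : ℂ) ^ ((j / N : ℝ) * Complex.I)),
      ← Complex.cpow_neg, Complex.cpow_def_of_ne_zero hn0' (-_), ← Complex.exp_nat_mul,
      ← Complex.natCast_log]
    congr 2
    push_cast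
    ring

/-- The strip of uniform but not absolute convergence has width at most `1 / 2`. -/
theorem abscissaOfAbsConv_le_add_half {a : ℕ → ℂ} {x : ℝ}
    (h : ConvergesUniformlyOn a {s : ℂ | x ≤ s.re}) :
    LSeries.abscissaOfAbsConv a ≤ ((x + 1 / 2 : ℝ) : EReal) := by
  refine LSeries.abscissaOfAbsConv_le_of_forall_lt_LSeriesSummable fun y hy => ?_
  obtain ⟨C, N₀, hC⟩ := partialSum_bounded h
  have hsq : Summable fun n : ℕ => ‖LSeries.term a x n‖ ^ 2 := by
    refine summable_of_sum_range_le (c := C ^ 2) (fun _ => sq_nonneg _) fun N => ?_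
    refine le_trans ?_ (sum_sq_norm_term_le (hC (max N N₀) (le_max_right _ _)))
    calc ∑ n ∈ Finset.range N, ‖LSeries.term a x n‖ ^ 2
        = ∑ n ∈ (Finset.range N).filter (1 ≤ ·), ‖LSeries.term a x n‖ ^ 2 := by
          rw [Finset.sum_filter]
          refine Finset.sum_congr rfl fun n _ => ?_
          rcases Nat.eq_zero_or_pos n with rfl | hn
          · simp
          · rw [if_pos (Nat.succ_le_of_lt hn)]
      _ ≤ _ := by
          refine Finset.sum_le_sum_of_subset_of_nonneg (fun n hn => ?_) fun _ _ _ => sq_nonneg _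
          simp only [Finset.mem_filter, Finset.mem_range] at hn
          exact Finset.mem_Icc.2 ⟨hn.2, hn.1.le.trans (le_max_left _ _)⟩
  have hpow : Summable fun n : ℕ => ((n : ℝ) ^ (2 * (y - x)))⁻¹ :=
    Real.summable_nat_rpow_inv.2 (by linarith)
  refine Summable.of_norm_bounded (hsq.add hpow) fun n => ?_
  rcases Nat.eq_zero_or_pos n with rfl | hn
  · simp only [LSeries.term_zero, norm_zero]; positivity
  have hn' : (0 : ℝ) < n := by exact_mod_cast hn
  -- Both factors are square summable, the second because `2 (y - x) > 1`; `u v ≤ u² + v²`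
  -- concludes.
  have e : ‖LSeries.term a y n‖ = ‖LSeries.term a x n‖ * ((n : ℝ) ^ (y - x))⁻¹ := by
    rw [LSeries.norm_term_eq, LSeries.norm_term_eq, if_neg hn.ne', if_neg hn.ne',
      Real.rpow_sub hn']
    simp only [Complex.ofReal_re]
    have := (Real.rpow_pos_of_pos hn' x).ne'
    field_simp
  rw [e, mul_comm 2 (y - x), Real.rpow_mul hn'.le, Real.rpow_two, ← inv_pow]
  nlinarith [sq_nonneg (‖LSeries.term a x n‖ - ((n : ℝ) ^ (y - x))⁻¹),
    sq_nonneg ‖LSeries.term a x n‖, sq_nonneg ((n : ℝ) ^ (y - x))⁻¹]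

theorem stripWidth_le (a : ℕ → ℂ) : stripWidth a ≤ ((1 / 2 : ℝ) : EReal) := by
  rw [stripWidth]
  by_cases htop : abscissaUnif a = ⊤
  · rw [htop]; simp
  by_cases hbot : LSeries.abscissaOfAbsConv a = ⊥
  · rw [hbot]; simp
  have key : LSeries.abscissaOfAbsConv a - ((1 / 2 : ℝ) : EReal) ≤ abscissaUnif a := by
    refine le_sInf ?_
    rintro _ ⟨x, hx, rfl⟩
    rw [EReal.sub_le_iff_le_add (Or.inl (EReal.coe_ne_bot _)) (Or.inl (EReal.coe_ne_top _)),
      ← EReal.coe_add]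
    exact abscissaOfAbsConv_le_add_half hx
  rw [EReal.sub_le_iff_le_add (Or.inl (EReal.coe_ne_bot _)) (Or.inl (EReal.coe_ne_top _))] at key
  -- Needed to move the subtracted abscissa across the inequality in `EReal`.
  have hB : abscissaUnif a ≠ ⊥ := by
    intro h
    rw [h, EReal.bot_add] at key
    exact hbot (le_bot_iff.1 key)
  rw [EReal.sub_le_iff_le_add (Or.inl hB) (Or.inl htop), add_comm]
  exact key

/-! ### Sign polynomials and uniform convergence -/

/-- The homogeneous polynomial of degree `k` with coefficients `ε`. -/
noncomputable def signPolynomial (n k : ℕ) (ε : (Fin n →₀ ℕ) → ℝ) : MvPolynomial (Fin n) ℂ :=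
  ∑ α ∈ Finset.finsuppAntidiag Finset.univ k, MvPolynomial.monomial α (ε α : ℂ)

theorem coeff_signPolynomial {n k : ℕ} (ε : (Fin n →₀ ℕ) → ℝ) {α : Fin n →₀ ℕ}
    (hα : α.degree = k) : (signPolynomial n k ε).coeff α = ε α := by
  classical
  rw [signPolynomial, MvPolynomial.coeff_sum]
  simp only [MvPolynomial.coeff_monomial]
  rw [Finset.sum_ite_eq', if_pos (mem_monomials.2 hα)]

theorem eval_signPolynomial {n k : ℕ} (ε : (Fin n →₀ ℕ) → ℝ) (z : Fin n → ℂ) :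
    MvPolynomial.eval z (signPolynomial n k ε) =
      ∑ α ∈ Finset.finsuppAntidiag Finset.univ k, (ε α : ℂ) * ∏ j, z j ^ α j := by
  rw [signPolynomial, map_sum]
  refine Finset.sum_congr rfl fun α _ => ?_
  rw [MvPolynomial.eval_monomial, Finsupp.prod_fintype _ _ fun _ => pow_zero _]

theorem isSignPolynomial_signPolynomial {n k : ℕ} {ε : (Fin n →₀ ℕ) → ℝ}
    (hε : ∀ α, ε α = 1 ∨ ε α = -1) : IsSignPolynomial k n (signPolynomial n k ε) := by
  refine ⟨MvPolynomial.IsHomogeneous.sum _ _ _ fun α hα =>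
    MvPolynomial.isHomogeneous_monomial _ (mem_monomials.1 hα), fun α hα => ?_⟩
  rw [coeff_signPolynomial ε hα]
  rcases hε α with h | h <;> simp [h]

theorem two_pow_le_of_mem_block {k n : ℕ} (hk : 2 ≤ k) (hn : n ∈ block k) : 2 ^ k ≤ n := by
  obtain ⟨α, hα, rfl⟩ := mem_block.1 hn
  have h0 : α ≠ 0 := by
    rintro rfl
    simp at hα
    omega
  obtain ⟨j, hj⟩ := Finsupp.ne_iff.1 h0
  exact (two_pow_le_blockPrime k j).trans (Nat.le_of_dvd (Nat.pos_of_ne_zero (blockInt_ne_zero k α))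
    ((dvd_pow_self _ hj).trans (Finset.dvd_prod_of_mem _ (Finset.mem_univ j))))

theorem sum_block_filter_eq_zero (a : ℕ → ℂ) (s : ℂ) {k N : ℕ} (hk : N ≤ k) :
    ∑ n ∈ (block (k + 2)).filter (· ≤ N), LSeries.term a s n = 0 := by
  refine Finset.sum_eq_zero fun n hn => ?_
  obtain ⟨h1, h2⟩ := Finset.mem_filter.1 hn
  have h3 := two_pow_le_of_mem_block (by omega) h1
  have h4 := Nat.lt_two_pow_self (n := k + 2)
  omega

/-- Elements of block `k` are at least `2^k > k`, so only finitely many blocks meet `[1, N]`. The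
index is shifted because blocks start at `k = 2`. -/
theorem partialSum_eq_tsum {a : ℕ → ℂ} (ha : ∀ n, (∀ k, 2 ≤ k → n ∉ block k) → a n = 0) (N : ℕ)
    (s : ℂ) : partialSum a N s =
      ∑' k : ℕ, ∑ n ∈ (block (k + 2)).filter (· ≤ N), LSeries.term a s n := by
  classical
  rw [tsum_eq_sum (s := Finset.range N) fun k hk =>
    sum_block_filter_eq_zero a s (not_lt.1 (Finset.mem_range.not.1 hk)), partialSum,
    ← Finset.sum_biUnion]
  · refine (Finset.sum_subset (fun n hn => ?_) fun n hn hn' => ?_).symm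
    · obtain ⟨k, _, h⟩ := Finset.mem_biUnion.1 hn
      obtain ⟨h1, h2⟩ := Finset.mem_filter.1 h
      exact Finset.mem_Icc.2 ⟨Nat.one_le_two_pow.trans (two_pow_le_of_mem_block (by omega) h1), h2⟩
    · have hN := (Finset.mem_Icc.1 hn).2
      have : a n = 0 := ha n fun k hk hnk => hn' (Finset.mem_biUnion.2 ⟨k - 2, ?_, ?_⟩)
      · simp [LSeries.term_def, this]
      · have h1 := two_pow_le_of_mem_block hk hnk
        have h2 := Nat.lt_two_pow_self (n := k)
        exact Finset.mem_range.2 (by omega)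
      · rw [Nat.sub_add_cancel hk]
        exact Finset.mem_filter.2 ⟨hnk, hN⟩
  · intro k _ l _ hkl
    exact Finset.disjoint_filter_filter (disjoint_block (by omega) (by omega))

/-- A series is uniformly convergent as soon as all the truncations of its blocks are small. -/
theorem convergesUniformlyOn_of_blocks {a : ℕ → ℂ}
    (ha : ∀ n, (∀ k, 2 ≤ k → n ∉ block k) → a n = 0) {S : Set ℂ} {b : ℕ → ℝ} (hb : Summable b)
    (h : ∀ k, ∀ N : ℕ, ∀ s ∈ S,
      ‖∑ n ∈ (block (k + 2)).filter (· ≤ N), LSeries.term a s n‖ ≤ b k) :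
    ConvergesUniformlyOn a S := by
  rcases S.eq_empty_or_nonempty with rfl | ⟨s₀, hs₀⟩
  · exact ⟨0, tendstoUniformlyOn_empty⟩
  have hb0 : ∀ k, 0 ≤ b k := fun k => (norm_nonneg _).trans (h k 0 s₀ hs₀)
  have hfull : ∀ k N : ℕ, (block (k + 2)).sup id ≤ N →
      (block (k + 2)).filter (· ≤ N) = block (k + 2) := fun k N hN =>
    Finset.filter_true_of_mem fun n hn => (Finset.le_sup (f := id) hn).trans hN
  have hF : ∀ k, ∀ s ∈ S, ‖∑ n ∈ block (k + 2), LSeries.term a s n‖ ≤ b k := by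
    intro k s hs
    have := h k ((block (k + 2)).sup id) s hs
    rwa [hfull k _ le_rfl] at this
  refine ⟨fun s => ∑' k : ℕ, ∑ n ∈ block (k + 2), LSeries.term a s n,
    Metric.tendstoUniformlyOn_iff.2 fun e he => ?_⟩
  -- Error of block `k + 2` at stage `N`, independent of `s`: none once the block is complete.
  -- Dominated convergence sends its sum to `0`.
  let g : ℕ → ℕ → ℝ := fun N k => if (block (k + 2)).sup id ≤ N then 0 else 2 * b k
  have hg : ∀ N k, ‖g N k‖ ≤ 2 * b k := by
    intro N k
    have := hb0 k
    simp only [g]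
    split_ifs
    · simpa using this
    · rw [Real.norm_of_nonneg (by positivity)]
  have hlim : Tendsto (fun N => ∑' k, g N k) atTop (nhds (∑' _ : ℕ, (0 : ℝ))) := by
    refine tendsto_tsum_of_dominated_convergence (hb.mul_left 2) (fun k => ?_)
      (Eventually.of_forall hg)
    refine tendsto_const_nhds.congr' ?_
    filter_upwards [eventually_ge_atTop ((block (k + 2)).sup id)] with N hN
    exact (if_pos hN).symm
  rw [tsum_zero] at hlim
  filter_upwards [hlim.eventually_lt_const he] with N hN s hs
  rw [dist_eq_norm, partialSum_eq_tsum ha, ← Summable.tsum_sub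
    (Summable.of_norm_bounded hb fun k => hF k s hs)
    (Summable.of_norm_bounded hb fun k => h k N s hs)]
  refine (tsum_of_norm_bounded (Summable.of_norm_bounded (hb.mul_left 2) (hg N)).hasSum
    fun k => ?_).trans_lt hN
  simp only [g]
  split_ifs with hk
  · rw [hfull k N hk, sub_self, norm_zero]
  · refine (norm_sub_le _ _).trans ?_
    linarith [hF k s hs, h k N s hs]

theorem prod_smul_pow_eq {n k : ℕ} (r : ℂ) (u : Fin n → ℂ) {α : Fin n →₀ ℕ} (hα : α.degree = k) :
    ∏ j, (r * u j) ^ α j = r ^ k * ∏ j, u j ^ α j := by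
  simp_rw [mul_pow]
  rw [Finset.prod_mul_distrib, Finset.prod_pow_eq_pow_sum, ← Finsupp.degree_eq_sum, hα]

theorem norm_blockPrime_cpow_le (k : ℕ) (j : Fin (2 ^ k)) {s : ℂ} {σ : ℝ} (hσ : 0 ≤ σ)
    (hs : σ ≤ s.re) : ‖(blockPrime k j : ℂ) ^ (-s)‖ ≤ ((2 ^ k : ℕ) : ℝ) ^ (-σ) := by
  have h1 : (1 : ℝ) ≤ (2 ^ k : ℕ) := by exact_mod_cast Nat.one_le_two_pow
  have h2 : ((2 ^ k : ℕ) : ℝ) ≤ blockPrime k j := by exact_mod_cast two_pow_le_blockPrime k j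
  rw [Complex.norm_natCast_cpow_of_pos (blockPrime_prime k j).pos, Complex.neg_re]
  exact (Real.rpow_le_rpow_of_exponent_le (h1.trans h2) (neg_le_neg hs)).trans
    (Real.rpow_le_rpow_of_nonpos (by linarith) h2 (by linarith))

/-- Each `p^(-s)` is `r` times a point of the unit disc, and homogeneity pulls out `r^k`. -/
theorem norm_sum_block_filter_le {a : ℕ → ℂ} {k : ℕ} {ε : (Fin (2 ^ k) →₀ ℕ) → ℝ} {B σ : ℝ}
    (ha : ∀ α : Fin (2 ^ k) →₀ ℕ, α.degree = k → a (blockInt k α) = ε α) {N : ℕ}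
    (hB : ∀ z : Fin (2 ^ k) → ℂ, (∀ j, ‖z j‖ ≤ 1) →
      ‖∑ α ∈ (Finset.finsuppAntidiag Finset.univ k).filter (blockInt k · ≤ N),
        (ε α : ℂ) * ∏ j, z j ^ α j‖ ≤ B) (hσ : 0 ≤ σ) {s : ℂ} (hs : σ ≤ s.re) :
    ‖∑ n ∈ (block k).filter (· ≤ N), LSeries.term a s n‖ ≤
      (((2 ^ k : ℕ) : ℝ) ^ (-σ)) ^ k * B := by
  set r : ℝ := ((2 ^ k : ℕ) : ℝ) ^ (-σ)
  have hr : 0 < r := Real.rpow_pos_of_pos (by positivity) _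
  have hr' : (r : ℂ) ≠ 0 := by exact_mod_cast hr.ne'
  set u : Fin (2 ^ k) → ℂ := fun j => (blockPrime k j : ℂ) ^ (-s) / r
  have hu : ∀ j, ‖u j‖ ≤ 1 := fun j => by
    rw [norm_div, Complex.norm_real, Real.norm_of_nonneg hr.le, div_le_one hr]
    exact norm_blockPrime_cpow_le k j hσ hs
  have hru : ∀ j, (blockPrime k j : ℂ) ^ (-s) = r * u j := fun j => (mul_div_cancel₀ _ hr').symm
  have e : ∑ n ∈ (block k).filter (· ≤ N), LSeries.term a s n =
      (r : ℂ) ^ k * ∑ α ∈ (Finset.finsuppAntidiag Finset.univ k).filter (blockInt k · ≤ N),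
        (ε α : ℂ) * ∏ j, u j ^ α j := by
    rw [block, Finset.filter_image, Finset.sum_image (blockInt_injective k).injOn, Finset.mul_sum]
    refine Finset.sum_congr rfl fun α hα => ?_
    have hα' := mem_monomials.1 (Finset.mem_filter.1 hα).1
    simp_rw [term_blockInt, ha α hα', hru]
    rw [prod_smul_pow_eq _ _ hα', mul_left_comm]
  rw [e, norm_mul, norm_pow, Complex.norm_real, Real.norm_of_nonneg hr.le]
  exact mul_le_mul_of_nonneg_left (hB u hu) (by positivity)

/-- The exponents of `2^k` add up to `1/2 - k δ`, which is at most `-1` once `k δ ≥ 3/2`. -/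
theorem summable_block_bound {δ : ℝ} (hδ : 0 < δ) :
    Summable fun k : ℕ => (((2 ^ k : ℕ) : ℝ) ^ (-(1 / 2 + δ))) ^ k *
      (62 * ((2 ^ k : ℕ) : ℝ) ^ (((k : ℝ) + 1) / 2)) := by
  have hgeom : Summable fun k : ℕ => 62 * (1 / 2 : ℝ) ^ k := summable_geometric_two.mul_left 62
  refine Summable.of_norm_bounded_eventually_nat hgeom ?_
  obtain ⟨K, hK⟩ := exists_nat_ge (3 / 2 / δ)
  filter_upwards [eventually_ge_atTop K] with k hk
  have hk' : 3 / 2 ≤ k * δ := by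
    have : (3 / 2 / δ) ≤ k := hK.trans (by exact_mod_cast hk)
    rwa [div_le_iff₀ hδ] at this
  rw [Real.norm_of_nonneg (by positivity)]
  have h1 : (1 : ℝ) ≤ (2 ^ k : ℕ) := by exact_mod_cast Nat.one_le_two_pow
  have h0 : (0 : ℝ) < (2 ^ k : ℕ) := by linarith
  calc _ = 62 * ((2 ^ k : ℕ) : ℝ) ^ (1 / 2 - k * δ) := by
        rw [← Real.rpow_natCast, ← Real.rpow_mul h0.le, mul_left_comm, ← Real.rpow_add h0]
        ring_nf
    _ ≤ 62 * ((2 ^ k : ℕ) : ℝ) ^ (-1 : ℝ) := by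
        exact mul_le_mul_of_nonneg_left (Real.rpow_le_rpow_of_exponent_le h1 (by linarith))
          (by norm_num)
    _ = _ := by
        rw [Real.rpow_neg_one, one_div, inv_pow]
        push_cast
        rfl

/-! ### Chebyshev's estimate and failure of absolute convergence -/

/-- Chebyshev's lower bound for `ψ(p)` is compared with `ψ(p) ≤ π(p) log p`, where `π(p) = m + 1`
because `Nat.nth` counts from `0`. -/
theorem nth_prime_mul_log_two_le (m : ℕ) :
    (Nat.nth Nat.Prime m : ℝ) * Real.log 2 ≤ 2 * (m + 2) * Real.log (Nat.nth Nat.Prime m) := by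
  set p := Nat.nth Nat.Prime m with hp
  have hpp : p.Prime := Nat.prime_nth_prime m
  have hp2 : (2 : ℝ) ≤ p := by exact_mod_cast hpp.two_le
  have hcount : p.primeCounting = m + 1 := by
    rw [Nat.primeCounting, Nat.primeCounting', Nat.count_succ, if_pos hpp]
    have := Nat.primeCounting'_nth_eq m
    rw [Nat.primeCounting', ← hp] at this
    rw [this]
  have h1 := Chebyshev.psi_ge p
  have h2 := Chebyshev.psi_le_primeCounting_mul_log p
  rw [hcount] at h2
  push_cast at h2
  have h3 : Real.log (p + 1) ≤ 2 * Real.log p := by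
    rw [← Real.log_rpow (by linarith)]
    refine Real.log_le_log (by linarith) ?_
    rw [Real.rpow_two]
    nlinarith
  have h4 : 0 ≤ Real.log p := Real.log_nonneg (by linarith)
  have h5 : 0 ≤ (m : ℝ) * Real.log p := by positivity
  linarith

/-- Chebyshev gives `p ≪ 2^k log p`, and any exponent `τ < 1` absorbs the logarithm. -/
theorem exists_blockPrime_rpow_le {τ : ℝ} (hτ : τ < 1) :
    ∃ C : ℝ, 0 < C ∧ ∀ (k : ℕ) (j : Fin (2 ^ k)), (blockPrime k j : ℝ) ^ τ ≤ C * 2 ^ k := by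
  have hl : 0 < Real.log 2 := Real.log_pos one_lt_two
  have hτ' : 0 < 1 - τ := by linarith
  refine ⟨8 / ((1 - τ) * Real.log 2), by positivity, fun k j => ?_⟩
  have h1 := nth_prime_mul_log_two_le (2 ^ k - 1 + (j : ℕ))
  change (blockPrime k j : ℝ) * Real.log 2 ≤ _ * Real.log (blockPrime k j) at h1
  have hp : (0 : ℝ) < blockPrime k j := by exact_mod_cast (blockPrime_prime k j).pos
  have h2 : (((2 ^ k - 1 + (j : ℕ) : ℕ) : ℝ) + 2) ≤ 4 * 2 ^ k := by
    have := j.2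
    have := Nat.one_le_two_pow (n := k)
    exact_mod_cast (by omega : 2 ^ k - 1 + (j : ℕ) + 2 ≤ 4 * 2 ^ k)
  have h3 := Real.log_le_rpow_div hp.le hτ'
  have h4 : 0 ≤ Real.log (blockPrime k j) :=
    Real.log_nonneg (by exact_mod_cast (blockPrime_prime k j).one_le)
  have h5 : (blockPrime k j : ℝ) * Real.log 2 ≤
      8 * 2 ^ k * ((blockPrime k j : ℝ) ^ (1 - τ) / (1 - τ)) := by
    refine h1.trans (mul_le_mul (by linarith) h3 h4 (by positivity))
  have h6 : (blockPrime k j : ℝ) = (blockPrime k j : ℝ) ^ τ * (blockPrime k j : ℝ) ^ (1 - τ) := by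
    rw [← Real.rpow_add hp]
    simp
  have h7 : 0 < (blockPrime k j : ℝ) ^ (1 - τ) := Real.rpow_pos_of_pos hp _
  have h8 : (blockPrime k j : ℝ) ^ τ * Real.log 2 ≤ 8 * 2 ^ k / (1 - τ) := by
    refine le_of_mul_le_mul_right ?_ h7
    calc _ = (blockPrime k j : ℝ) * Real.log 2 := by nth_rw 3 [h6]; ring
      _ ≤ _ := h5
      _ = _ := by ring
  rw [← le_div_iff₀ hl] at h8
  refine h8.trans_eq ?_
  field_simp

/-- Each monomial of the block contributes at least `D^(-k)` to the sum. -/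
theorem card_monomials_le_of_summable {a : ℕ → ℂ} {k : ℕ}
    (ha : ∀ α : Fin (2 ^ k) →₀ ℕ, α.degree = k → ‖a (blockInt k α)‖ = 1) {σ D : ℝ}
    (hD : ∀ j, (blockPrime k j : ℝ) ^ σ ≤ D) (hs : Summable fun n => ‖LSeries.term a σ n‖) :
    ((Finset.finsuppAntidiag (Finset.univ : Finset (Fin (2 ^ k))) k).card : ℝ) ≤
      (∑' n, ‖LSeries.term a σ n‖) * D ^ k := by
  have hp : ∀ j, (0 : ℝ) < blockPrime k j := fun j => by
    exact_mod_cast (blockPrime_prime k j).pos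
  have hD0 : 0 < D := (Real.rpow_pos_of_pos (hp ⟨0, by positivity⟩) σ).trans_le (hD _)
  have h1 : ∀ α ∈ Finset.finsuppAntidiag (Finset.univ : Finset (Fin (2 ^ k))) k,
      (1 / D ^ k : ℝ) ≤ ‖LSeries.term a σ (blockInt k α)‖ := by
    intro α hα
    have hα' := mem_monomials.1 hα
    rw [LSeries.norm_term_eq, if_neg (blockInt_ne_zero k α), ha α hα', Complex.ofReal_re]
    refine one_div_le_one_div_of_le (Real.rpow_pos_of_pos
      (by exact_mod_cast Nat.pos_of_ne_zero (blockInt_ne_zero k α)) _) ?_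
    calc ((blockInt k α : ℕ) : ℝ) ^ σ = ∏ j, ((blockPrime k j : ℝ) ^ σ) ^ α j := by
          rw [blockInt, Nat.cast_prod, ← Real.finsetProd_rpow _ _ fun j _ => Nat.cast_nonneg _]
          refine Finset.prod_congr rfl fun j _ => ?_
          rw [Nat.cast_pow, ← Real.rpow_natCast, ← Real.rpow_natCast, ← Real.rpow_mul (hp j).le,
            ← Real.rpow_mul (hp j).le, mul_comm]
      _ ≤ ∏ j, D ^ α j := by
          refine Finset.prod_le_prod (fun j _ => ?_) fun j _ => ?_
          · exact pow_nonneg (Real.rpow_nonneg (hp j).le _) _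
          · exact pow_le_pow_left₀ (Real.rpow_nonneg (hp j).le _) (hD j) _
      _ = D ^ k := by rw [Finset.prod_pow_eq_pow_sum, ← Finsupp.degree_eq_sum, hα']
  have h2 := Finset.card_nsmul_le_sum _ _ _ h1
  have h3 : ∑ α ∈ Finset.finsuppAntidiag (Finset.univ : Finset (Fin (2 ^ k))) k,
      ‖LSeries.term a σ (blockInt k α)‖ ≤ ∑' n, ‖LSeries.term a σ n‖ := by
    rw [← Finset.sum_image (f := fun n => ‖LSeries.term a σ n‖) (blockInt_injective k).injOn]
    exact hs.sum_le_tsum _ fun _ _ => norm_nonneg _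
  have h4 := h2.trans h3
  rwa [nsmul_eq_mul, mul_one_div, div_le_iff₀ (by positivity)] at h4

theorem not_summable_norm_term {a : ℕ → ℂ}
    (ha : ∀ k, 2 ≤ k → ∀ α : Fin (2 ^ k) →₀ ℕ, α.degree = k → ‖a (blockInt k α)‖ = 1) {σ : ℝ}
    (hσ0 : 0 < σ) (hσ1 : σ < 1) : ¬ Summable fun n => ‖LSeries.term a σ n‖ := by
  intro hs
  set T := ∑' n, ‖LSeries.term a σ n‖
  have hT : 0 ≤ T := tsum_nonneg fun _ => norm_nonneg _
  -- An exponent strictly between `σ` and `1` leaves `ρ < 1`, so `2^(k(1-ρ))` beats `k`, the price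
  -- of `k! ≤ k^k`.
  obtain ⟨C, hC, hCp⟩ := exists_blockPrime_rpow_le (τ := (1 + σ) / 2) (by linarith)
  set ρ := σ / ((1 + σ) / 2) with hρ
  have hρ0 : 0 < ρ := by positivity
  have hρ1 : ρ < 1 := by rw [hρ, div_lt_one (by linarith)]; linarith
  have hr1 : (1 : ℝ) < 2 ^ (1 - ρ) := Real.one_lt_rpow one_lt_two (by linarith)
  have hlim := tendsto_pow_const_div_const_pow_of_one_lt 1 hr1
  have hCρ : 0 < C ^ ρ := Real.rpow_pos_of_pos hC _
  obtain ⟨k, hk2, hk⟩ := ((eventually_ge_atTop 2).and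
    (hlim.eventually_lt_const (show (0 : ℝ) < 1 / ((T + 1) * C ^ ρ) by positivity))).exists
  rw [pow_one, div_lt_div_iff₀ (by positivity) (by positivity), one_mul] at hk
  have hD : ∀ j, (blockPrime k j : ℝ) ^ σ ≤ (C * 2 ^ k) ^ ρ := by
    intro j
    calc (blockPrime k j : ℝ) ^ σ = ((blockPrime k j : ℝ) ^ ((1 + σ) / 2)) ^ ρ := by
          rw [← Real.rpow_mul (Nat.cast_nonneg _), hρ, mul_div_cancel₀ _ (by linarith)]
      _ ≤ _ := Real.rpow_le_rpow (by positivity) (hCp k j) hρ0.le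
  have h1 := card_monomials_le_of_summable (ha k hk2) hD hs
  set D := (C * 2 ^ k : ℝ) ^ ρ with hDdef
  have hD0 : 0 < D := by positivity
  have h2 : (T + 1) * k * D ≤ 2 ^ k := by
    have h3 : D = C ^ ρ * (2 ^ k : ℝ) ^ ρ := Real.mul_rpow hC.le (by positivity)
    have h4 : ((2 : ℝ) ^ (1 - ρ)) ^ k * (2 ^ k : ℝ) ^ ρ = 2 ^ k := by
      rw [← Real.rpow_natCast, ← Real.rpow_natCast, ← Real.rpow_mul two_pos.le,
        ← Real.rpow_mul two_pos.le, ← Real.rpow_add two_pos]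
      ring_nf
    rw [h3]
    calc _ = k * ((T + 1) * C ^ ρ) * (2 ^ k : ℝ) ^ ρ := by ring
      _ ≤ ((2 : ℝ) ^ (1 - ρ)) ^ k * (2 ^ k : ℝ) ^ ρ := by gcongr
      _ = _ := h4
  have h5 : (((2 ^ k) ^ k : ℕ) : ℝ) ≤ (k.factorial * (Finset.finsuppAntidiag
      (Finset.univ : Finset (Fin (2 ^ k))) k).card : ℕ) := by
    exact_mod_cast pow_le_factorial_mul_card_monomials (2 ^ k) k
  push_cast at h5
  have h6 : (k.factorial : ℝ) ≤ k ^ k := by exact_mod_cast k.factorial_le_pow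
  have hf : (0 : ℝ) < k.factorial := by exact_mod_cast k.factorial_pos
  have h7 : (T + 1) * (k.factorial * D ^ k) ≤ T * (k.factorial * D ^ k) := by
    calc (T + 1) * (k.factorial * D ^ k) ≤ (T + 1) ^ k * (k ^ k * D ^ k) := by
          gcongr
          exact le_self_pow₀ (by linarith) (by omega)
      _ = ((T + 1) * k * D) ^ k := by rw [mul_pow, mul_pow, mul_assoc]
      _ ≤ (2 ^ k) ^ k := by gcongr
      _ ≤ _ := h5
      _ ≤ k.factorial * (T * D ^ k) := by gcongr
      _ = _ := by ring
  have h8 : 0 < k.factorial * D ^ k := by positivity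
  linarith

theorem not_convergesAbsolutelyAt {a : ℕ → ℂ}
    (ha : ∀ k, 2 ≤ k → ∀ α : Fin (2 ^ k) →₀ ℕ, α.degree = k → ‖a (blockInt k α)‖ = 1) {s : ℂ}
    (hs : s.re < 1) : ¬ ConvergesAbsolutelyAt a s := fun h =>
  not_summable_norm_term ha (σ := max s.re (1 / 2)) (lt_max_of_lt_right (by norm_num))
    (max_lt hs (by norm_num)) (Summable.of_nonneg_of_le (fun _ => norm_nonneg _)
      (fun n => LSeries.norm_term_le_of_re_le_re a (by simp) n) h)

/-! ### The extremal series -/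

theorem exists_series :
    ∃ (a : ℕ → ℂ) (ε : (k : ℕ) → (Fin (2 ^ k) →₀ ℕ) → ℝ), (∀ k α, ε k α = 1 ∨ ε k α = -1) ∧
      IsAssembledFrom a (fun k => signPolynomial (2 ^ k) k (ε k)) ∧
      ∀ k, 2 ≤ k → ∀ (N : ℕ) (z : Fin (2 ^ k) → ℂ), (∀ j, ‖z j‖ ≤ 1) →
        ‖∑ α ∈ (Finset.finsuppAntidiag Finset.univ k).filter (blockInt k · ≤ N),
            (ε k α : ℂ) * ∏ j, z j ^ α j‖ ≤ 62 * ((2 ^ k : ℕ) : ℝ) ^ (((k : ℝ) + 1) / 2) := by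
  have h : ∀ k : ℕ, ∃ ε : (Fin (2 ^ k) →₀ ℕ) → ℝ, (∀ α, ε α = 1 ∨ ε α = -1) ∧ (2 ≤ k →
      ∀ (N : ℕ) (z : Fin (2 ^ k) → ℂ), (∀ j, ‖z j‖ ≤ 1) →
        ‖∑ α ∈ (Finset.finsuppAntidiag Finset.univ k).filter (blockInt k · ≤ N),
            (ε α : ℂ) * ∏ j, z j ^ α j‖ ≤ 62 * ((2 ^ k : ℕ) : ℝ) ^ (((k : ℝ) + 1) / 2)) := by
    intro k
    by_cases hk : 2 ≤ k
    · obtain ⟨ε, h1, h2⟩ := exists_signs_truncations_le hk (blockInt k)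
      exact ⟨ε, h1, fun _ => h2⟩
    · exact ⟨fun _ => 1, fun _ => Or.inl rfl, fun h => absurd h hk⟩
  choose ε hε hB using h
  obtain ⟨a, ha⟩ := exists_isAssembledFrom fun k => signPolynomial (2 ^ k) k (ε k)
  exact ⟨a, ε, hε, ha, hB⟩

/-- The lower bound needs no further analysis: uniform convergence to the left of `1/2` would force
`A < 1` by the width estimate. -/
theorem abscissaUnif_eq_half {a : ℕ → ℂ} (hA : LSeries.abscissaOfAbsConv a = ((1 : ℝ) : EReal))
    (h : ∀ δ : ℝ, 0 < δ → ConvergesUniformlyOn a {s : ℂ | 1 / 2 + δ ≤ s.re}) :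
    abscissaUnif a = ((1 / 2 : ℝ) : EReal) := by
  refine le_antisymm (EReal.le_of_forall_lt_iff_le.1 fun z hz => ?_) (le_sInf ?_)
  · have hz' : 1 / 2 < z := by exact_mod_cast hz
    refine sInf_le ⟨z, ?_, rfl⟩
    have := h (z - 1 / 2) (by linarith)
    rwa [add_sub_cancel] at this
  · rintro _ ⟨x, hx, rfl⟩
    have := abscissaOfAbsConv_le_add_half hx
    rw [hA, EReal.coe_le_coe_iff] at this
    exact EReal.coe_le_coe_iff.2 (by linarith)

end BohrStrip

theorem mainTheorem2 :
    (∃ (a : ℕ → ℂ) (Q : (k : ℕ) → MvPolynomial (Fin (2 ^ k)) ℂ) (c : ℝ),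
      -- the polynomials: degree `k`, `2 ^ k` variables, coefficients `±1`, small sup norm
      (∀ k : ℕ, 2 ≤ k →
        BohrStrip.IsSignPolynomial k (2 ^ k) (Q k) ∧
        ∀ z : Fin (2 ^ k) → ℂ, (∀ j, ‖z j‖ ≤ 1) →
          ‖MvPolynomial.eval z (Q k)‖ <
            c * ((2 ^ k : ℕ) : ℝ) ^ (((k : ℝ) + 1) / 2) * Real.sqrt (Real.log (k : ℝ))) ∧
      -- the series: its `k`-th block is `Q k` evaluated at `p ^ (-s)`, `p` in a block of primes
      BohrStrip.IsAssembledFrom a Q ∧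
      (∀ k l : ℕ, 2 ≤ k → 2 ≤ l → k ≠ l →
        Disjoint (BohrStrip.block k) (BohrStrip.block l)) ∧
      (∀ k : ℕ, 2 ≤ k → ∀ s : ℂ,
        ∑ n ∈ BohrStrip.block k, LSeries.term a s n =
          MvPolynomial.eval (fun j => (BohrStrip.blockPrime k j : ℂ) ^ (-s)) (Q k)) ∧
      -- coefficients, uniform convergence, failure of absolute convergence
      (∀ n : ℕ, a n = 0 ∨ a n = 1 ∨ a n = -1) ∧
      (∀ δ : ℝ, 0 < δ →
        BohrStrip.ConvergesUniformlyOn a {s : ℂ | 1 / 2 + δ ≤ s.re}) ∧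
      (∀ s : ℂ, s.re < 1 → ¬ BohrStrip.ConvergesAbsolutelyAt a s) ∧
      -- its strip of uniform, nonabsolute convergence is `1/2 < Re s < 1`
      LSeries.abscissaOfAbsConv a = ((1 : ℝ) : EReal) ∧
      BohrStrip.abscissaUnif a = ((1 / 2 : ℝ) : EReal) ∧
      BohrStrip.stripWidth a = ((1 / 2 : ℝ) : EReal)) ∧
    -- `1/2` is the maximal width over all Dirichlet series
    IsGreatest (Set.range BohrStrip.stripWidth) ((1 / 2 : ℝ) : EReal) := by
  obtain ⟨a, ε, hε, ha, hB⟩ := BohrStrip.exists_series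
  have hcoeff : ∀ k, 2 ≤ k → ∀ α : Fin (2 ^ k) →₀ ℕ, α.degree = k →
      a (BohrStrip.blockInt k α) = ε k α := fun k hk α hα => by
    rw [ha.1 k hk α hα, BohrStrip.coeff_signPolynomial _ hα]
  have hnorm : ∀ k, 2 ≤ k → ∀ α : Fin (2 ^ k) →₀ ℕ, α.degree = k →
      ‖a (BohrStrip.blockInt k α)‖ = 1 := fun k hk α hα => by
    rw [hcoeff k hk α hα]
    rcases hε k α with h | h <;> simp [h]
  have hvalues : ∀ n, a n = 0 ∨ a n = 1 ∨ a n = -1 := by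
    intro n
    by_cases hn : ∃ k, 2 ≤ k ∧ n ∈ BohrStrip.block k
    · obtain ⟨k, hk, hn⟩ := hn
      obtain ⟨α, hα, rfl⟩ := BohrStrip.mem_block.1 hn
      rw [hcoeff k hk α hα]
      rcases hε k α with h | h <;> simp [h]
    · exact Or.inl (ha.2 n fun k hk h => hn ⟨k, hk, h⟩)
  have hunif : ∀ δ : ℝ, 0 < δ → BohrStrip.ConvergesUniformlyOn a {s : ℂ | 1 / 2 + δ ≤ s.re} :=
    fun δ hδ => BohrStrip.convergesUniformlyOn_of_blocks ha.2
      ((summable_nat_add_iff 2).2 (BohrStrip.summable_block_bound hδ)) fun k N s hs =>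
        BohrStrip.norm_sum_block_filter_le (hcoeff (k + 2) (by omega))
          (hB (k + 2) (by omega) N) (by positivity) hs
  have hnot : ∀ s : ℂ, s.re < 1 → ¬ BohrStrip.ConvergesAbsolutelyAt a s :=
    fun s hs => BohrStrip.not_convergesAbsolutelyAt hnorm hs
  have hA : LSeries.abscissaOfAbsConv a = ((1 : ℝ) : EReal) := by
    refine le_antisymm (LSeries.abscissaOfAbsConv_le_of_le_const ⟨1, fun n _ => ?_⟩) (le_sInf ?_)
    · rcases hvalues n with h | h | h <;> simp [h]
    · rintro _ ⟨x, hx, rfl⟩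
      refine EReal.coe_le_coe_iff.2 (not_lt.1 fun hx1 => hnot x (by simpa using hx1) ?_)
      exact Summable.norm hx
  have hU := BohrStrip.abscissaUnif_eq_half hA hunif
  have hW : BohrStrip.stripWidth a = ((1 / 2 : ℝ) : EReal) := by
    rw [BohrStrip.stripWidth, hA, hU, ← EReal.coe_sub]
    norm_num
  refine ⟨⟨a, fun k => BohrStrip.signPolynomial (2 ^ k) k (ε k), 63 / √(Real.log 2),
    fun k hk => ⟨BohrStrip.isSignPolynomial_signPolynomial (hε k), fun z hz => ?_⟩, ha,
    fun k l hk _ hkl => BohrStrip.disjoint_block hk hkl, fun k hk s => ?_, hvalues, hunif, hnot,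
    hA, hU, hW⟩, ⟨a, hW⟩, ?_⟩
  -- Truncating at the largest integer of the block keeps the whole polynomial.
  · have hsum := hB k hk ((BohrStrip.block k).sup id) z hz
    have hmax : ∀ α ∈ Finset.finsuppAntidiag (Finset.univ : Finset (Fin (2 ^ k))) k,
        BohrStrip.blockInt k α ≤ (BohrStrip.block k).sup id := fun α hα =>
      Finset.le_sup (f := id) (BohrStrip.mem_block.2 ⟨α, BohrStrip.mem_monomials.1 hα, rfl⟩)
    rw [Finset.filter_true_of_mem hmax, ← BohrStrip.eval_signPolynomial] at hsum
    have hl : 0 < √(Real.log 2) := Real.sqrt_pos.2 (Real.log_pos one_lt_two)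
    have hlk : √(Real.log 2) ≤ √(Real.log k) :=
      Real.sqrt_le_sqrt (Real.log_le_log two_pos (by exact_mod_cast hk))
    have hr : 0 < ((2 ^ k : ℕ) : ℝ) ^ (((k : ℝ) + 1) / 2) := Real.rpow_pos_of_pos (by positivity) _
    calc _ ≤ 62 * ((2 ^ k : ℕ) : ℝ) ^ (((k : ℝ) + 1) / 2) := hsum
      _ < 63 * ((2 ^ k : ℕ) : ℝ) ^ (((k : ℝ) + 1) / 2) := by linarith
      _ = 63 / √(Real.log 2) * ((2 ^ k : ℕ) : ℝ) ^ (((k : ℝ) + 1) / 2) * √(Real.log 2) := by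
          field_simp
      _ ≤ _ := by gcongr
  · have h := BohrStrip.sum_block_term ha hk (fun _ => True) s
    rw [Finset.filter_true, Finset.filter_true] at h
    rw [h, BohrStrip.eval_signPolynomial]
    refine Finset.sum_congr rfl fun α hα => ?_
    rw [BohrStrip.coeff_signPolynomial _ (BohrStrip.mem_monomials.1 hα)]
  · rintro _ ⟨b, rfl⟩
    exact BohrStrip.stripWidth_le b
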